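/- Let $F$ be a field with algebraic closure $F^{\mathrm{alg}}$. A polynomial $Q\in F[x]$ is \emph{hereditarily irreducible} over $F$ if $Q(x^n)$ is irreducible over $F$ for every integer $n\ge 1$. A polynomial $P\in F[x]$ \emph{has good heredity} over $F$ if for some integer $n\ge 1$ the polynomial $P(x^n)$ is, up to a nonzero constant factor, a (possibly empty) product of hereditarily irreducible polynomials over $F$. The field $F$ \emph{has good heredity} if every $P\in F[x]$ none of whose zeros in $F^{\mathrm{alg}}$ is $0$ or a root of unity has good heredity over $F$. The field $F$ is \emph{rootless} if for every $a\in F^\times$ that is not a root of unity there are only finitely many integers $n\ge 1$ such that $x^n=a$ is solvable in $F$; it is \emph{rootless modtor} if for every $a\in F^\times$ that is not a root of unity there are only finitely many integers $n\ge 1$ such that $x^n=\zeta a$ is solvable in $F$ for some root of unity $\zeta\in F$. A \emph{global field} is a number field or a finite extension of $k(t)$ for a finite field $k$. (1) For every prime $p$, the field $\mathbb{F}_p^{\mathrm{alg}}$ has good heredity. An algebraically closed field has good heredity if and only if it is isomorphic to $\mathbb{F}_p^{\mathrm{alg}}$ for some prime $p$. (2) Every global field is rootless, rootless modtor, and of good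 heredity. (3) If $F$ has good heredity and $E$ is a finitely generated field extension of $F$, then $E$ has good heredity. -/

import Mathlib

open Polynomial

/-- `P` is hereditarily irreducible over `F`: `P(x ^ n)` is irreducible over `F` for every
positive integer `n`. -/
def HereditarilyIrreducible {F : Type*} [Field F] (P : F[X]) : Prop :=
  ∀ n : ℕ, 0 < n → Irreducible (expand F n P)

/-- `P` has good heredity over `F`: for some positive integer `n`, the polynomial `P(x ^ n)` is,
up to a nonzero constant, a (finite, possibly empty) product of polynomials that are hereditarily
irreducible over `F`; factors may be repeated. -/
def PolynomialGoodHeredity {F : Type*} [Field F] (P : F[X]) : Prop :=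
  ∃ n : ℕ, 0 < n ∧ ∃ s : Multiset F[X],
    (∀ Q ∈ s, HereditarilyIrreducible Q) ∧ Associated s.prod (expand F n P)

/-- A root of unity: `a ^ n = 1` for some positive integer `n`. -/
def IsUnityRoot {F : Type*} [Field F] (a : F) : Prop :=
  ∃ n : ℕ, 0 < n ∧ a ^ n = 1

/-- The field `F` has good heredity: every polynomial over `F` none of whose zeros in the algebraic
closure of `F` is zero or a root of unity has good heredity over `F`. -/
def FieldGoodHeredity (F : Type*) [Field F] : Prop :=
  ∀ P : F[X], (∀ a : AlgebraicClosure F, aeval a P = 0 → a ≠ 0 ∧ ¬ IsUnityRoot a) →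
    PolynomialGoodHeredity P

/-- `a` is rootless in `F`: `x ^ n = a` has a solution in `F` for only finitely many positive
integers `n`. -/
def ElementRootless {F : Type*} [Field F] (a : F) : Prop :=
  {n : ℕ | 0 < n ∧ ∃ x : F, x ^ n = a}.Finite

/-- `a` is rootless modulo torsion in `F`: for only finitely many positive integers `n` is there
a root of unity `ζ` in `F` such that `x ^ n = ζ * a` has a solution in `F`. -/
def ElementRootlessModtor {F : Type*} [Field F] (a : F) : Prop :=
  {n : ℕ | 0 < n ∧ ∃ ζ : F, IsUnityRoot ζ ∧ ∃ x : F, x ^ n = ζ * a}.Finite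

/-- The field `F` is rootless: every nonzero element that is not a root of unity is rootless. -/
def FieldRootless (F : Type*) [Field F] : Prop :=
  ∀ a : F, a ≠ 0 → ¬ IsUnityRoot a → ElementRootless a

/-- The field `F` is rootless modulo torsion: every nonzero element that is not a root of unity is
rootless modulo torsion. -/
def FieldRootlessModtor (F : Type*) [Field F] : Prop :=
  ∀ a : F, a ≠ 0 → ¬ IsUnityRoot a → ElementRootlessModtor a

/-- A global field: a number field, or a finite extension of the field of rational functions in
one variable over a finite field. -/
def IsGlobalField (K : Type*) [Field K] : Prop :=
  NumberField K ∨
    ∃ (k : Type) (_ : Field k) (_ : Finite k) (_ : Algebra (RatFunc k) K),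
      FiniteDimensional (RatFunc k) K

/-! The proof turns on a criterion, `fieldGoodHeredity_of_fieldRootless`: `F` has good heredity once
every simple algebraic extension `F(α)` is rootless. Let `α` be a root of an irreducible `P`, and `K
= F(α)`. It suffices to find `n` and an extension `L` of `K` containing a square root of `-1` and
all `n`-th roots of `α`, none of them a `p`-th power in `L` for any prime `p`. Each factor of `P(x ^
n)` is then, up to a constant, the minimal polynomial of such a root `β`, and `X ^ m - β` is
irreducible over `L`, hence over `F(β)`, for all `m`.

`L` is `K` with the roots of unity of order dividing some power of `R = B!`, where `α` is not an
`n`-th power in `K` for `n > B`. The danger is that `α` acquires unboundedly many roots in `L`. Two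
Kummer-style descents exclude this: if `α` is a `p ^ k`-th power in `L`, then some power of `α`,
with exponent independent of `k`, is a `p ^ k`-th power in `K`. They are
`exists_pow_eq_of_notMem_range` and `exists_pow_eq_of_forall_mem_range`.

Conversely, a finitely generated extension of a field of good heredity is rootless, because its
algebraic elements have bounded degree; with the criterion this gives (3). Function fields follow
from (3) over a finite field, number fields from a height argument, and (1) from the fact that an
algebraically closed field has no irreducible polynomial of degree above one. -/

open IntermediateField in
/-- If `-1` is a square in `K` and `a` is not a `p`-th power in `K` for any prime `p`, then
`X ^ n - a` is irreducible for every positive `n`. -/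
theorem irreducible_X_pow_sub_C_of_forall_prime {K : Type*} [Field K] {i a : K} (hi : i ^ 2 = -1)
    (ha : ∀ p : ℕ, p.Prime → ∀ b : K, b ^ p ≠ a) {n : ℕ} (hn : 0 < n) :
    Irreducible (X ^ n - C a) := by
  induction n using induction_on_primes generalizing K a with
  | zero => simp at hn
  | one => simpa using irreducible_X_sub_C a
  | prime_mul p n hp IH =>
    rw [mul_comm]
    apply X_pow_mul_sub_C_irreducible (X_pow_sub_C_irreducible_of_prime hp (ha p hp))
    intro E _ _ x hx
    have hint : IsIntegral K x := not_not.mp fun h ↦ by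
      simpa only [degree_zero, degree_X_pow_sub_C hp.pos,
        WithBot.natCast_ne_bot] using congr_arg degree (hx.symm.trans (dif_neg h))
    apply IH (i := algebraMap K _ i) (by rw [← map_pow, hi]; simp)
      (hn := Nat.pos_of_mul_pos_left hn)
    intro q hq b hb
    -- If the root `x` were `b ^ q` in `K(x)`, taking norms would make `a`, up to sign, a `q`-th
    -- power in `K`. The sign is wrong only for `p = 2`; it is absorbed by `-1` for odd `q` and by
    -- `i` for `q = 2`.
    have hnorm : Algebra.norm K b ^ q = (-1) ^ p * -a := by
      rw [← map_pow, hb, ← adjoin.powerBasis_gen hint,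
        Algebra.PowerBasis.norm_gen_eq_coeff_zero_minpoly]
      simp [minpoly_gen, hx, hp.ne_zero.symm]
    rcases hp.eq_two_or_odd' with rfl | hpo
    · rcases hq.eq_two_or_odd' with rfl | hqo
      · exact ha 2 hq (i * Algebra.norm K b) (by rw [mul_pow, hnorm, hi]; ring)
      · exact ha q hq (-Algebra.norm K b) (by rw [hqo.neg_pow, hnorm]; ring)
    · exact ha q hq (Algebra.norm K b) (by rw [hnorm, hpo.neg_one_pow]; ring)

/-- If `a ^ u` is a `q`-th power in a field, then so is `a ^ gcd(u, q)`, and hence `a ^ v` for any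
multiple `v` of the gcd. -/
theorem exists_pow_eq_pow_of_gcd_dvd {K : Type*} [Field K] {a b : K} {u q v : ℕ}
    (ha : a ≠ 0) (h : b ^ q = a ^ u) (hv : Nat.gcd u q ∣ v) : ∃ c : K, c ^ q = a ^ v := by
  obtain ⟨w, rfl⟩ := hv
  refine ⟨(b ^ Nat.gcdA u q * a ^ Nat.gcdB u q) ^ w, ?_⟩
  by_cases hb : b = 0
  · subst hb
    by_cases hq : q = 0
    · subst hq
      simp only [pow_zero, Nat.gcd_zero_right] at h ⊢
      rw [pow_mul, ← h, one_pow]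
    · rw [zero_pow hq] at h
      exact absurd h.symm (pow_ne_zero _ ha)
  have key : (b ^ Nat.gcdA u q * a ^ Nat.gcdB u q) ^ q = a ^ Nat.gcd u q := by
    have hbz := Nat.gcd_eq_gcd_ab u q
    rw [mul_pow, ← zpow_natCast (b ^ _), ← zpow_mul, mul_comm (Nat.gcdA u q), zpow_mul,
      zpow_natCast, h, ← zpow_natCast a u, ← zpow_mul, ← zpow_natCast (a ^ _), ← zpow_mul,
      ← zpow_add₀ ha, mul_comm (Nat.gcdB u q), ← hbz, zpow_natCast]
  rw [← pow_mul, mul_comm w, pow_mul, key, ← pow_mul]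

/-! ### Bounded degree of algebraic elements in finitely generated extensions -/

section BoundedDegree

variable {F K : Type*} [Field F] [Field K] [Algebra F K]

/-- Elements algebraic and linearly independent over `F` stay linearly independent over the
algebra generated by an algebraically independent family. -/
theorem AlgebraicIndependent.linearIndependent_adjoin {ι κ : Type*} {x : ι → K}
    (hx : AlgebraicIndependent F x) {e : κ → algebraicClosure F K}
    (he : LinearIndependent F e) :
    LinearIndependent (Algebra.adjoin F (Set.range x)) (fun k => (e k : K)) := by
  have hxA : AlgebraicIndependent (algebraicClosure F K) x := hx.algebraicClosure
  rw [linearIndependent_iff']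
  intro s g hg k hk
  set f : κ → MvPolynomial ι F := fun k => hx.aevalEquiv.symm (g k)
  have hf : ∀ k, MvPolynomial.aeval x (f k) = (g k : K) := fun k => by
    rw [← hx.algebraMap_aevalEquiv]
    simp [f]
  -- A linear relation is the vanishing at `x` of a polynomial over the algebraic closure of `F` in
  -- `K`. Since `x` is independent over that closure too, all coefficients vanish.
  set G : MvPolynomial ι (algebraicClosure F K) :=
    ∑ k ∈ s, MvPolynomial.C (e k) * (f k).map (algebraMap F _)
  have hG : MvPolynomial.aeval x G = 0 := by
    rw [← hg]
    simp only [G, map_sum, map_mul, MvPolynomial.aeval_C, MvPolynomial.aeval_map_algebraMap, hf]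
    refine Finset.sum_congr rfl fun k _ => ?_
    rw [Algebra.smul_def, mul_comm]
    rfl
  have hG0 : G = 0 := (map_eq_zero_iff _ hxA).mp hG
  have hfk : f k = 0 := by
    ext m
    have h1 : MvPolynomial.coeff m G = 0 := by rw [hG0]; simp
    simp only [G, MvPolynomial.coeff_sum, MvPolynomial.coeff_C_mul, MvPolynomial.coeff_map] at h1
    have h2 := linearIndependent_iff'.mp he s (fun k => MvPolynomial.coeff m (f k))
      (by rw [← h1]; exact Finset.sum_congr rfl fun k _ => by rw [Algebra.smul_def, mul_comm])
    simpa using h2 k hk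
  simpa [f] using hfk

open scoped IntermediateField.algebraAdjoinAdjoin in
/-- In a finitely generated field extension the algebraic elements have bounded degree. -/
theorem exists_natDegree_minpoly_le [Algebra.EssFiniteType F K] :
    ∃ D : ℕ, ∀ c : K, IsAlgebraic F c → (minpoly F c).natDegree ≤ D := by
  obtain ⟨s, hs⟩ := exists_isTranscendenceBasis F K
  let M := IntermediateField.adjoin F (Set.range ((↑) : s → K))
  have halg : Algebra.IsAlgebraic M K := hs.isAlgebraic_field
  have : Algebra.EssFiniteType M K := .of_comp F M K
  have hfin : Module.Finite M K := Algebra.finite_of_essFiniteType_of_isAlgebraic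
  refine ⟨Module.finrank M K, fun c hc => ?_⟩
  let c' : algebraicClosure F K := ⟨c, mem_algebraicClosure_iff.mpr hc⟩
  have hmin : minpoly F c' = minpoly F c :=
    (minpoly.algebraMap_eq (algebraMap (algebraicClosure F K) K).injective c').symm
  -- The powers of `c` below its degree over `F` stay independent over `M`, so that degree is at
  -- most `[K : M]`.
  have hli := linearIndependent_pow (K := F) c'
  have h2 := hs.1.linearIndependent_adjoin hli
  have h3 := (LinearIndependent.iff_fractionRing (Algebra.adjoin F (Set.range ((↑) : s → K))) M).mp h2
  have := h3.fintype_card_le_finrank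
  rw [hmin] at this
  simpa using this

end BoundedDegree

/-! ### Cyclotomic extensions and descent of `p ^ k`-th powers -/

section Cyclotomic

variable (K : Type*) (Ω : Type*) [Field K] [Field Ω] [Algebra K Ω]

/-- The subextension of `Ω` generated over `K` by the `M`-th roots of unity. -/
def rootsOfUnityAdjoin (M : ℕ) : IntermediateField K Ω :=
  IntermediateField.adjoin K {ζ : Ω | ζ ^ M = 1}

variable {K Ω}

theorem mem_rootsOfUnityAdjoin {M : ℕ} {ζ : Ω} (h : ζ ^ M = 1) : ζ ∈ rootsOfUnityAdjoin K Ω M :=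
  IntermediateField.subset_adjoin K _ h

theorem rootsOfUnityAdjoin_le_of_dvd {M N : ℕ} (h : M ∣ N) :
    rootsOfUnityAdjoin K Ω M ≤ rootsOfUnityAdjoin K Ω N := by
  obtain ⟨d, rfl⟩ := h
  exact IntermediateField.adjoin.mono _ _ _ fun ζ hζ => by
    rw [Set.mem_ofPred_eq] at hζ ⊢
    rw [pow_mul, hζ, one_pow]

/-- `M` may be divisible by the characteristic, but the exact order of `ζ` is not. -/
theorem isSeparable_of_pow_eq_one {M : ℕ} (hM : 0 < M) {ζ : Ω} (h : ζ ^ M = 1) :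
    IsSeparable K ζ := by
  have hpos : 0 < orderOf ζ := orderOf_pos_iff.mpr (isOfFinOrder_iff_pow_eq_one.mpr ⟨M, hM, h⟩)
  have : NeZero (orderOf ζ) := ⟨hpos.ne'⟩
  have hne : NeZero ((orderOf ζ : ℕ) : Ω) := (IsPrimitiveRoot.orderOf ζ).neZero'
  have hneK : ((orderOf ζ : ℕ) : K) ≠ 0 := fun h0 => hne.out (by
    rw [← map_natCast (algebraMap K Ω), h0, map_zero])
  have hsep : (X ^ orderOf ζ - 1 : K[X]).Separable := X_pow_sub_one_separable_iff.mpr hneK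
  exact hsep.of_dvd (minpoly.dvd K ζ (by simp [pow_orderOf_eq_one]))

theorem apply_eq_self_of_mem_rootsOfUnityAdjoin {M : ℕ} {ρ : Ω ≃ₐ[K] Ω}
    (hρ : ∀ ζ : Ω, ζ ^ M = 1 → ρ ζ = ζ) {x : Ω} (hx : x ∈ rootsOfUnityAdjoin K Ω M) :
    ρ x = x := by
  induction hx using IntermediateField.adjoin_induction with
  | mem ζ hζ => exact hρ ζ hζ
  | algebraMap c => simp
  | add x y _ _ hx hy => simp [hx, hy]
  | inv x _ hx => simp [hx]
  | mul x y _ _ hx hy => simp [hx, hy]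

theorem pow_eq_self_of_modEq_one {M u : ℕ} (hu : u ≡ 1 [MOD M]) {ζ : Ω} (hζ : ζ ^ M = 1) :
    ζ ^ u = ζ := by
  have := pow_eq_pow_of_modEq hu hζ
  rwa [pow_one] at this

/-- Automorphisms commute on cyclotomic extensions. -/
theorem comm_of_mem_rootsOfUnityAdjoin {M : ℕ} (hM : 0 < M) (σ τ : Ω ≃ₐ[K] Ω) {x : Ω}
    (hx : x ∈ rootsOfUnityAdjoin K Ω M) : σ (τ x) = τ (σ x) := by
  have : NeZero M := ⟨hM.ne'⟩
  induction hx using IntermediateField.adjoin_induction with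
  | mem ζ hζ =>
    have key : ∀ ρ : Ω ≃ₐ[K] Ω, ∃ m : ℕ, ρ ζ = ζ ^ m := fun ρ => by
      obtain ⟨m, hm⟩ := map_rootsOfUnity_eq_pow_self ρ (rootsOfUnity.mkOfPowEq ζ hζ)
      exact ⟨m, by simpa using hm⟩
    obtain ⟨a, ha⟩ := key σ
    obtain ⟨b, hb⟩ := key τ
    rw [hb, map_pow, ha, map_pow, hb, ← pow_mul, ← pow_mul, mul_comm]
  | algebraMap c => simp
  | add x y _ _ hx hy => simp [hx, hy]
  | inv x _ hx => simp [hx]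
  | mul x y _ _ hx hy => simp [hx, hy]

/-- An automorphism raises all `N`-th roots of unity to a common power, coprime to `N`. -/
theorem exists_coprime_forall_apply_eq_pow {N : ℕ} (hN : 0 < N) (σ : Ω ≃ₐ[K] Ω) :
    ∃ u : ℕ, u.Coprime N ∧ ∀ ξ : Ω, ξ ^ N = 1 → σ ξ = ξ ^ u := by
  have : NeZero N := ⟨hN.ne'⟩
  obtain ⟨g, hg⟩ := IsCyclic.exists_generator (α := rootsOfUnity N Ω)
  set ω : Ω := ((g : Ωˣ) : Ω)
  have hωN : ω ^ N = 1 := (mem_rootsOfUnity' N _).mp g.2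
  have hdvd : orderOf ω ∣ N := orderOf_dvd_of_pow_eq_one hωN
  have hω := IsPrimitiveRoot.orderOf ω
  have : NeZero (orderOf ω) := ⟨(Nat.pos_of_dvd_of_pos hdvd hN).ne'⟩
  obtain ⟨i, -, hi, hiω⟩ := hω.isPrimitiveRoot_iff.mp (hω.map_of_injective σ.injective)
  -- In positive characteristic the order of `ω` may be a proper divisor of `N`; the exponent is
  -- lifted to a unit modulo `N`.
  obtain ⟨v, hv⟩ := ZMod.unitsMap_surjective hdvd (ZMod.unitOfCoprime i hi)
  refine ⟨(v : ZMod N).val, ZMod.val_coe_unit_coprime v, fun ξ hξ => ?_⟩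
  have hmod : (v : ZMod N).val ≡ i [MOD orderOf ω] := by
    rw [← ZMod.natCast_eq_natCast_iff]
    have := congrArg Units.val hv
    rw [ZMod.unitsMap_val, ZMod.coe_unitOfCoprime] at this
    rw [← this, ZMod.natCast_val]
  have hσω : σ ω = ω ^ (v : ZMod N).val :=
    hiω.symm.trans (pow_eq_pow_of_modEq hmod.symm (pow_orderOf_eq_one ω))
  obtain ⟨k, hk⟩ := hg (rootsOfUnity.mkOfPowEq ξ hξ)
  have hk' : ξ = ω ^ k := by
    have := congrArg (fun t : rootsOfUnity N Ω => ((t : Ωˣ) : Ω)) hk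
    simpa using this.symm
  rw [hk', map_zpow₀, hσω, ← zpow_natCast, ← zpow_natCast, ← zpow_mul, ← zpow_mul, mul_comm]

variable [IsAlgClosure K Ω]

/-- A separable element of the algebraic closure fixed by all automorphisms is in the base. -/
theorem mem_range_of_forall_apply_eq {x : Ω} (hx : IsSeparable K x)
    (h : ∀ σ : Ω ≃ₐ[K] Ω, σ x = x) : ∃ c : K, algebraMap K Ω c = x := by
  have hn : Normal K Ω := IsAlgClosure.normal K Ω
  by_contra hc
  have : x ∉ (⊥ : Subalgebra K Ω) := fun hb => hc (Algebra.mem_bot.mp hb)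
  obtain ⟨y, hxy, hy⟩ := (notMem_iff_exists_ne_and_isConjRoot hx (hn.splits x)).mp this
  obtain ⟨τ, hτ⟩ := isConjRoot_iff_exists_algEquiv.mp (IsConjRoot.symm hy)
  exact hxy ((h τ).symm.trans hτ)

theorem mem_range_of_mem_rootsOfUnityAdjoin {M : ℕ} (hM : 0 < M) {x : Ω}
    (hx : x ∈ rootsOfUnityAdjoin K Ω M) (h : ∀ σ : Ω ≃ₐ[K] Ω, σ x = x) :
    ∃ c : K, algebraMap K Ω c = x := by
  have hs : Algebra.IsSeparable K (rootsOfUnityAdjoin K Ω M) :=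
    (IntermediateField.isSeparable_adjoin_iff_isSeparable K Ω).mpr
      fun ζ hζ => isSeparable_of_pow_eq_one hM hζ
  have := hs.isSeparable' ⟨x, hx⟩
  refine mem_range_of_forall_apply_eq ?_ h
  rw [IsSeparable] at this ⊢
  rwa [← minpoly.algebraMap_eq (algebraMap (rootsOfUnityAdjoin K Ω M) Ω).injective] at this

/-- If `a` is a `q`-th power in a cyclotomic extension of `K`, where `q = p ^ k`, and some root of
unity of order dividing `p ^ r` is not in `K`, then `a ^ p ^ (r - 1)` is a `q`-th power in `K`. -/
theorem exists_pow_eq_of_notMem_range {p k r : ℕ} (hp : p.Prime) (hrk : r ≤ k) {ζ : Ω}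
    (hζ : ζ ^ p ^ r = 1) (hζK : ¬ ∃ z : K, algebraMap K Ω z = ζ) {M : ℕ} (hM : 0 < M) {c : Ω}
    (hc : c ∈ rootsOfUnityAdjoin K Ω M) {a : K} (ha : a ≠ 0)
    (hca : c ^ p ^ k = algebraMap K Ω a) : ∃ b : K, b ^ p ^ k = a ^ p ^ (r - 1) := by
  have hpk : 0 < p ^ k := pow_pos hp.pos k
  -- The enlarged level also contains the `p ^ k`-th root of unity `τ c / c`.
  have hM' : 0 < M * p ^ k := Nat.mul_pos hM hpk
  have hc' := rootsOfUnityAdjoin_le_of_dvd (Dvd.intro _ rfl : M ∣ M * p ^ k) hc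
  have hc0 : c ≠ 0 := by
    rintro rfl
    rw [zero_pow hpk.ne'] at hca
    exact ha ((map_eq_zero _).mp hca.symm)
  obtain ⟨τ, hτ⟩ : ∃ τ : Ω ≃ₐ[K] Ω, τ ζ ≠ ζ := by
    by_contra hcon
    push Not at hcon
    exact hζK (mem_range_of_forall_apply_eq (isSeparable_of_pow_eq_one (pow_pos hp.pos r) hζ) hcon)
  obtain ⟨u, -, hu⟩ := exists_coprime_forall_apply_eq_pow hpk τ
  have hζk : ζ ^ p ^ k = 1 := by
    obtain ⟨d, hd⟩ := pow_dvd_pow p hrk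
    rw [hd, pow_mul, hζ, one_pow]
  -- With `σ c = ξ c`, commutativity gives `σ (τ c) = τ ξ * τ c = ξ ^ u * τ c`, and `c ^ u` is
  -- multiplied by the same `ξ ^ u`.
  have hfix : ∀ σ : Ω ≃ₐ[K] Ω, σ (τ c / c ^ u) = τ c / c ^ u := fun σ => by
    have hξ : (σ c / c) ^ p ^ k = 1 := by
      rw [div_pow, ← map_pow, hca, AlgEquiv.commutes, div_self]
      exact fun h => ha ((map_eq_zero _).mp h)
    have h1 := hu _ hξ
    have hτc : τ c ≠ 0 := fun h => hc0 ((map_eq_zero τ).mp h)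
    have hσc : σ c ≠ 0 := fun h => hc0 ((map_eq_zero σ).mp h)
    rw [map_div₀, map_pow, comm_of_mem_rootsOfUnityAdjoin hM' σ τ hc']
    rw [map_div₀, div_pow] at h1
    field_simp at h1 ⊢
    rw [← h1]
  have hmem : τ c / c ^ u ∈ rootsOfUnityAdjoin K Ω (M * p ^ k) := by
    have hξ : (τ c / c) ^ p ^ k = 1 := by
      rw [div_pow, ← map_pow, hca, AlgEquiv.commutes, div_self]
      exact fun h => ha ((map_eq_zero _).mp h)
    have h1 : τ c / c ∈ rootsOfUnityAdjoin K Ω (M * p ^ k) :=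
      mem_rootsOfUnityAdjoin (by rw [mul_comm, pow_mul, hξ, one_pow])
    have h2 : τ c = τ c / c * c := by field_simp
    rw [h2]
    exact div_mem (mul_mem h1 hc') (pow_mem hc' u)
  obtain ⟨b, hb⟩ := mem_range_of_mem_rootsOfUnityAdjoin hM' hmem hfix
  have hbu : b ^ p ^ k * a ^ u = a := by
    apply (algebraMap K Ω).injective
    rw [map_mul, map_pow, hb, map_pow, ← hca, div_pow, ← map_pow, hca, AlgEquiv.commutes, ← hca]
    have := pow_ne_zero (p ^ k) hc0
    field_simp
    ring
  -- As `τ` moves `ζ`, `u - 1` is not divisible by `p ^ r`. Since `a ^ (1 - u)` is a `p ^ k`-th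
  -- power in `K`, Bézout finishes.
  have hndvd : ∀ n : ℕ, u ≡ n + 1 [MOD p ^ r] → ¬ p ^ r ∣ n := fun n hn hd => by
    apply hτ
    rw [hu ζ hζk]
    have : u ≡ 1 [MOD p ^ r] := hn.trans (by
      simpa using (Nat.modEq_zero_iff_dvd.mpr hd).add_right 1)
    exact pow_eq_self_of_modEq_one this hζ
  have hgcd : ∀ n : ℕ, ¬ p ^ r ∣ n → Nat.gcd n (p ^ k) ∣ p ^ (r - 1) := fun n hn => by
    obtain ⟨s, hs, hsg⟩ := (Nat.dvd_prime_pow hp).mp (Nat.gcd_dvd_right n (p ^ k))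
    rw [hsg]
    apply pow_dvd_pow
    by_contra hlt
    push Not at hlt
    exact hn ((pow_dvd_pow p (by lia)).trans (hsg ▸ Nat.gcd_dvd_left n (p ^ k)))
  rcases Nat.eq_zero_or_pos u with rfl | hupos
  · refine exists_pow_eq_pow_of_gcd_dvd (u := 1) (b := b) ha ?_ ?_
    · simpa using hbu
    · simp
  · obtain ⟨n, rfl⟩ : ∃ n, u = n + 1 := ⟨u - 1, by lia⟩
    refine exists_pow_eq_pow_of_gcd_dvd (u := n) (b := b⁻¹) ha ?_ (hgcd n (hndvd n rfl))
    rw [inv_pow]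
    rw [pow_succ] at hbu
    have h3 : b ^ p ^ k * a ^ n = 1 := mul_right_cancel₀ ha (by rw [one_mul, mul_assoc, hbu])
    exact (eq_inv_of_mul_eq_one_right h3).symm

/-- If `a` is a `q`-th power in the extension of `K` by `R ^ j`-th roots of unity, where `q = p ^ k`
with `p` prime to `R`, and the `q`-th roots of unity are in `K`, then `a ^ φ(R)` is a `q`-th power
in `K`. -/
theorem exists_pow_eq_of_forall_mem_range {p k : ℕ} {R j : ℕ} (hR : 0 < R)
    (hpR : R.Coprime p) (hζK : ∀ ζ : Ω, ζ ^ p ^ k = 1 → ∃ z : K, algebraMap K Ω z = ζ) {c : Ω}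
    (hc : c ∈ rootsOfUnityAdjoin K Ω (R ^ j)) {a : K} (ha : a ≠ 0)
    (hca : c ^ p ^ k = algebraMap K Ω a) : ∃ b : K, b ^ p ^ k = a ^ Nat.totient R := by
  have haΩ : algebraMap K Ω a ≠ 0 := fun h => ha ((map_eq_zero _).mp h)
  have hRj : 0 < R ^ (j + 1) := pow_pos hR _
  have hfix : ∀ σ : Ω ≃ₐ[K] Ω, σ (c ^ Nat.totient R) = c ^ Nat.totient R := fun σ => by
    rcases eq_or_ne c 0 with rfl | hc0
    · rw [← map_zero (algebraMap K Ω), ← map_pow, AlgEquiv.commutes]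
    obtain ⟨u, huR, hu⟩ := exists_coprime_forall_apply_eq_pow hRj σ
    -- Thus the `φ(R) R ^ j`-th iterate of `σ` fixes `c`. It multiplies `c` by `ξ ^ (φ(R) R ^ j)`,
    -- because `ξ` lies in `K`. The order of `ξ` is a power of `p`, prime to `R`, so it divides
    -- `φ(R)`, a bound independent of `j` and `k`.
    have hmod : u ^ (Nat.totient R * R ^ j) ≡ 1 [MOD R ^ (j + 1)] := by
      have h1 : u ^ Nat.totient R ≡ 1 [MOD R] :=
        Nat.ModEq.pow_totient (Nat.Coprime.coprime_dvd_right (dvd_pow_self R (by lia)) huR)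
      rw [Nat.ModEq.comm, Nat.modEq_iff_dvd] at h1 ⊢
      push_cast at h1 ⊢
      have := dvd_sub_pow_of_dvd_sub h1 j
      rwa [one_pow, ← pow_mul] at this
    have hiter : ∀ (n : ℕ) (ξ : Ω), ξ ^ R ^ (j + 1) = 1 → (σ ^ n) ξ = ξ ^ u ^ n := by
      intro n ξ hξ
      induction n with
      | zero => simp
      | succ n ih =>
        rw [pow_succ', AlgEquiv.mul_apply, ih, map_pow, hu ξ hξ, ← pow_mul, pow_succ']
    set ξ := σ c / c
    have hξ : ξ ^ p ^ k = 1 := by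
      rw [div_pow, ← map_pow, hca, AlgEquiv.commutes, div_self haΩ]
    have hσc : σ c = c * ξ := by simp only [ξ]; field_simp
    obtain ⟨z, hz⟩ := hζK ξ hξ
    have hσξ : σ ξ = ξ := by rw [← hz, AlgEquiv.commutes]
    have hiterc : ∀ n : ℕ, (σ ^ n) c = c * ξ ^ n := fun n => by
      induction n with
      | zero => simp
      | succ n ih =>
        rw [pow_succ', AlgEquiv.mul_apply, ih, map_mul, map_pow, hσξ, hσc, pow_succ']
        ring
    have hT : (σ ^ (Nat.totient R * R ^ j)) c = c := by
      refine apply_eq_self_of_mem_rootsOfUnityAdjoin (M := R ^ (j + 1)) (fun ζ hζ => ?_)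
        (rootsOfUnityAdjoin_le_of_dvd (pow_dvd_pow R (Nat.le_succ j)) hc)
      rw [hiter _ ζ hζ, pow_eq_self_of_modEq_one hmod hζ]
    rw [hiterc] at hT
    have hξT : ξ ^ (Nat.totient R * R ^ j) = 1 := mul_left_cancel₀ hc0 (by rw [hT, mul_one])
    have hord : orderOf ξ ∣ Nat.totient R := by
      have h1 := orderOf_dvd_of_pow_eq_one hξT
      have h2 := orderOf_dvd_of_pow_eq_one hξ
      exact (Nat.Coprime.coprime_dvd_left h2
        (Nat.Coprime.pow k j hpR.symm)).dvd_of_dvd_mul_right h1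
    rw [map_pow, hσc, mul_pow, orderOf_dvd_iff_pow_eq_one.mp hord, mul_one]
  obtain ⟨b, hb⟩ := mem_range_of_mem_rootsOfUnityAdjoin (pow_pos hR j) (pow_mem hc _) hfix
  refine ⟨b, (algebraMap K Ω).injective ?_⟩
  rw [map_pow, hb, map_pow, ← hca, ← pow_mul, ← pow_mul, mul_comm]

end Cyclotomic

/-! ### The tower of `R ^ j`-th cyclotomic extensions -/

section Tower

variable {K Ω : Type*} [Field K] [Field Ω] [Algebra K Ω]

/-- By Bézout, `η` is a product of powers of `η ^ m` and `η ^ n`. This removes the `p`-part of `R`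
when the `p`-power roots of unity are already in `K`. -/
theorem rootsOfUnityAdjoin_mul_le {m n : ℕ} (hmn : m.Coprime n)
    (hm : ∀ ζ : Ω, ζ ^ m = 1 → ∃ z : K, algebraMap K Ω z = ζ) :
    rootsOfUnityAdjoin K Ω (m * n) ≤ rootsOfUnityAdjoin K Ω n := by
  refine IntermediateField.adjoin_le_iff.mpr fun η hη => ?_
  replace hη : η ^ (m * n) = 1 := hη
  rcases eq_or_ne η 0 with rfl | hη0
  · exact zero_mem _
  have h1 : η ^ m ∈ rootsOfUnityAdjoin K Ω n := mem_rootsOfUnityAdjoin (by rw [← pow_mul, hη])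
  have h2 : η ^ n ∈ rootsOfUnityAdjoin K Ω n := by
    obtain ⟨z, hz⟩ := hm (η ^ n) (by rw [← pow_mul, mul_comm, hη])
    exact hz ▸ IntermediateField.algebraMap_mem _ z
  have h3 : η = (η ^ m) ^ Nat.gcdA m n * (η ^ n) ^ Nat.gcdB m n := by
    rw [← zpow_natCast, ← zpow_natCast, ← zpow_mul, ← zpow_mul, ← zpow_add₀ hη0,
      ← Nat.gcd_eq_gcd_ab, hmn.gcd_eq_one, Nat.cast_one, zpow_one]
  rw [SetLike.mem_coe, h3]
  exact mul_mem (zpow_mem h1 _) (zpow_mem h2 _)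

variable (K Ω) in
/-- The subextension of `Ω` generated over `K` by all roots of unity whose order divides a power
of `R`. -/
def rootsOfUnityTower (R : ℕ) : IntermediateField K Ω :=
  ⨆ j : ℕ, rootsOfUnityAdjoin K Ω (R ^ j)

theorem mem_rootsOfUnityTower {R : ℕ} {x : Ω} :
    x ∈ rootsOfUnityTower K Ω R ↔ ∃ j : ℕ, x ∈ rootsOfUnityAdjoin K Ω (R ^ j) := by
  have hdir : Directed (· ≤ ·) fun j : ℕ => rootsOfUnityAdjoin K Ω (R ^ j) :=
    (monotone_nat_of_le_succ fun j =>
      rootsOfUnityAdjoin_le_of_dvd (pow_dvd_pow R (Nat.le_succ j))).directed_le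
  rw [rootsOfUnityTower, ← SetLike.mem_coe, IntermediateField.coe_iSup_of_directed hdir,
    Set.mem_iUnion]
  rfl

theorem mem_rootsOfUnityTower_of_pow_eq_one {R n j : ℕ} (hn : n ∣ R ^ j) {η : Ω}
    (hη : η ^ n = 1) : η ∈ rootsOfUnityTower K Ω R :=
  mem_rootsOfUnityTower.mpr ⟨j, rootsOfUnityAdjoin_le_of_dvd hn (mem_rootsOfUnityAdjoin hη)⟩

end Tower

theorem ElementRootless.exists_forall_lt {F : Type*} [Field F] {a : F} (h : ElementRootless a) :
    ∃ B : ℕ, ∀ n, B < n → ∀ x : F, x ^ n ≠ a := by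
  obtain ⟨B, hB⟩ := h.bddAbove
  refine ⟨B, fun n hn x hx => ?_⟩
  have := hB ⟨by lia, x, hx⟩
  lia

/-- Every prime factor of `φ(B!)` divides `B!` or some `q - 1` with `q ≤ B` prime, so it is at most
`B`. -/
theorem Nat.Prime.coprime_totient_factorial {p B : ℕ} (hp : p.Prime) (hpB : B < p) :
    (Nat.totient B.factorial).Coprime p := by
  rw [Nat.coprime_comm, hp.coprime_iff_not_dvd]
  intro hd
  have h1 : p ∣ B.factorial * ∏ q ∈ B.factorial.primeFactors, (q - 1) := by
    rw [← Nat.totient_mul_prod_primeFactors]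
    exact hd.mul_right _
  rcases hp.dvd_mul.mp h1 with h | h
  · exact absurd (hp.dvd_factorial.mp h) (by lia)
  · obtain ⟨q, hq, hpq⟩ := (hp.prime.dvd_finsetProd_iff _).mp h
    have hqp := Nat.prime_of_mem_primeFactors hq
    have hqB := hqp.dvd_factorial.mp (Nat.dvd_of_mem_primeFactors hq)
    have := Nat.le_of_dvd (by have := hqp.two_le; lia) hpq
    lia

/-! ### Bounding the roots of `a` in the tower and choosing `n` -/

section Core

variable {K Ω : Type*} [Field K] [Field Ω] [Algebra K Ω] [IsAlgClosure K Ω]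

/-- For each prime `p`, an element all of whose powers are rootless is not an iterated `p`-th power
in a tower of cyclotomic extensions beyond some bounded exponent. -/
theorem exists_forall_mem_rootsOfUnityTower_pow_ne {a : K} (ha : a ≠ 0)
    (hroot : ∀ N : ℕ, 0 < N → ElementRootless (a ^ N)) {R : ℕ} (hR : 0 < R) {p : ℕ}
    (hp : p.Prime) :
    ∃ k : ℕ, ∀ c ∈ rootsOfUnityTower K Ω R, c ^ p ^ k ≠ algebraMap K Ω a := by
  by_cases hcase : ∃ (r : ℕ) (ζ : Ω), ζ ^ p ^ r = 1 ∧ ¬ ∃ z : K, algebraMap K Ω z = ζ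
  · obtain ⟨r, ζ, hζ, hζK⟩ := hcase
    obtain ⟨B, hB⟩ := (hroot (p ^ (r - 1)) (pow_pos hp.pos _)).exists_forall_lt
    -- This exponent is at least `r`, as the descent requires, and makes `p ^ k` exceed `B`.
    refine ⟨r + B, fun c hc hca => ?_⟩
    obtain ⟨j, hj⟩ := mem_rootsOfUnityTower.mp hc
    obtain ⟨b, hb⟩ := exists_pow_eq_of_notMem_range hp (Nat.le_add_right r B) hζ hζK
      (pow_pos hR j) hj ha hca
    have := Nat.lt_pow_self hp.one_lt (n := r + B)
    exact hB (p ^ (r + B)) (by lia) b hb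
  · push Not at hcase
    obtain ⟨e, R', hR', hRR⟩ := Nat.exists_eq_pow_mul_and_not_dvd hR.ne' p hp.ne_one
    have hR'0 : 0 < R' := Nat.pos_of_ne_zero fun h => hR' (h ▸ dvd_zero p)
    have hcop : R'.Coprime p := ((hp.coprime_iff_not_dvd).mpr hR').symm
    obtain ⟨B, hB⟩ := (hroot (Nat.totient R') (Nat.totient_pos.mpr hR'0)).exists_forall_lt
    refine ⟨B, fun c hc hca => ?_⟩
    obtain ⟨j, hj⟩ := mem_rootsOfUnityTower.mp hc
    rw [hRR, mul_pow, ← pow_mul] at hj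
    have hj' := rootsOfUnityAdjoin_mul_le (Nat.Coprime.pow _ _ hcop.symm) (hcase (e * j)) hj
    obtain ⟨b, hb⟩ := exists_pow_eq_of_forall_mem_range hR'0 hcop (hcase B) hj' ha hca
    exact hB (p ^ B) (Nat.lt_pow_self hp.one_lt) b hb

/-- For primes above `B` the descents lose nothing: the exponent is `p ^ 0`, or `φ(B!)`, which is
prime to `p`. -/
theorem forall_mem_rootsOfUnityTower_factorial_pow_ne {a : K} (ha : a ≠ 0) {B p : ℕ}
    (hp : p.Prime) (hpB : B < p) (hpow : ∀ x : K, x ^ p ≠ a) :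
    ∀ c ∈ rootsOfUnityTower K Ω B.factorial, c ^ p ≠ algebraMap K Ω a := by
  intro c hc hca
  have hR := Nat.factorial_pos B
  obtain ⟨j, hj⟩ := mem_rootsOfUnityTower.mp hc
  rw [← pow_one p] at hca
  by_cases hcase : ∃ ζ : Ω, ζ ^ p ^ 1 = 1 ∧ ¬ ∃ z : K, algebraMap K Ω z = ζ
  · obtain ⟨ζ, hζ, hζK⟩ := hcase
    obtain ⟨b, hb⟩ := exists_pow_eq_of_notMem_range hp le_rfl hζ hζK (pow_pos hR j) hj ha hca
    exact hpow b (by simpa using hb)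
  · push Not at hcase
    have hcop : B.factorial.Coprime p :=
      ((hp.coprime_iff_not_dvd).mpr fun h => absurd (hp.dvd_factorial.mp h) (by lia)).symm
    obtain ⟨b, hb⟩ := exists_pow_eq_of_forall_mem_range hR hcop hcase hj ha hca
    rw [pow_one] at hb
    obtain ⟨d, hd⟩ := exists_pow_eq_pow_of_gcd_dvd (v := 1) ha hb
      (by rw [(hp.coprime_totient_factorial hpB).gcd_eq_one])
    exact hpow d (by simpa using hd)

/-- If all powers of `a` are rootless in `K`, then for some `n` all `n`-th roots of `a` lie in an
extension of `K` containing a square root of `-1` in which none of them is a `p`-th power. -/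
theorem exists_pos_intermediateField_pow_ne {a : K} (ha : a ≠ 0)
    (hroot : ∀ N : ℕ, 0 < N → ElementRootless (a ^ N)) :
    ∃ n : ℕ, 0 < n ∧ ∃ L : IntermediateField K Ω, (∃ i ∈ L, i ^ 2 = -1) ∧
      ∀ β : Ω, β ^ n = algebraMap K Ω a →
        β ∈ L ∧ ∀ p : ℕ, p.Prime → ∀ γ ∈ L, γ ^ p ≠ β := by
  have haΩ : algebraMap K Ω a ≠ 0 := fun h => ha ((map_eq_zero _).mp h)
  obtain ⟨B₀, hB₀⟩ := (hroot 1 one_pos).exists_forall_lt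
  rw [pow_one] at hB₀
  -- `B ≥ 2` makes `R` even, which puts the fourth roots of unity in the tower.
  obtain ⟨B, hB2, hB⟩ : ∃ B, 2 ≤ B ∧ ∀ n, B < n → ∀ x : K, x ^ n ≠ a :=
    ⟨B₀ + 2, by lia, fun n hn => hB₀ n (by lia)⟩
  have hR : 0 < B.factorial := B.factorial_pos
  set R := B.factorial
  have hpR : ∀ p : ℕ, p.Prime → p ≤ B → p ∣ R := fun p hp h => hp.dvd_factorial.mpr h
  choose! k hk using fun (p : ℕ) (hp : p.Prime) =>
    exists_forall_mem_rootsOfUnityTower_pow_ne (Ω := Ω) ha hroot hR hp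
  -- The maximum of `A` serves as `n`: a `p`-th root of an `n`-th root of `a` would put `p * n` in
  -- `A` if `p ≤ B`, and would make `a` a `p`-th power in the tower if `p > B`.
  set A : Set ℕ := {n | (∃ j, n ∣ R ^ j) ∧
    ∃ c ∈ rootsOfUnityTower K Ω R, c ^ n = algebraMap K Ω a}
  have hpos : ∀ n ∈ A, 0 < n := fun n hn => by
    obtain ⟨⟨j, hj⟩, -⟩ := hn
    exact Nat.pos_of_dvd_of_pos hj (pow_pos hR j)
  have hbdd : BddAbove A := by
    refine ⟨∏ p ∈ (Finset.range (B + 1)).filter Nat.Prime, p ^ k p, fun n hn => ?_⟩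
    have hn0 := hpos n hn
    obtain ⟨⟨j, hj⟩, c, hc, hca⟩ := hn
    refine Nat.le_of_dvd (Finset.prod_pos fun p hp =>
      pow_pos (Finset.mem_filter.mp hp).2.pos _) ?_
    have h1 : n = ∏ p ∈ n.primeFactors, p ^ n.factorization p :=
      (Nat.prod_factorization_pow_eq_self hn0.ne').symm
    rw [h1]
    refine (Finset.prod_dvd_prod_of_dvd _ (fun p => p ^ k p) fun p hp => ?_).trans
      (Finset.prod_dvd_prod_of_subset _ _ _ fun p hp => ?_)
    · have hpp := Nat.prime_of_mem_primeFactors hp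
      refine pow_dvd_pow p ?_
      by_contra hlt
      push Not at hlt
      obtain ⟨d, hd⟩ := (pow_dvd_pow p hlt.le).trans (Nat.ordProj_dvd n p)
      exact hk p hpp (c ^ d) (pow_mem hc d) (by rw [← pow_mul, mul_comm, ← hd, hca])
    · have hpp := Nat.prime_of_mem_primeFactors hp
      have : p ≤ B := hpp.dvd_factorial.mp
        (hpp.dvd_of_dvd_pow ((Nat.dvd_of_mem_primeFactors hp).trans hj))
      exact Finset.mem_filter.mpr ⟨Finset.mem_range.mpr (by lia), hpp⟩
  have hne : A.Nonempty := ⟨1, ⟨0, by simp⟩, algebraMap K Ω a,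
    IntermediateField.algebraMap_mem _ a, pow_one _⟩
  obtain ⟨n, hn, hmax⟩ : ∃ n ∈ A, ∀ m ∈ A, m ≤ n :=
    ⟨sSup A, Nat.sSup_mem hne hbdd, fun m hm => le_csSup hbdd hm⟩
  have hn0 := hpos n hn
  obtain ⟨⟨j, hj⟩, c, hc, hca⟩ := hn
  refine ⟨n, hn0, rootsOfUnityTower K Ω R, ?_, fun β hβ => ⟨?_, fun p hp γ hγ hγβ => ?_⟩⟩
  · have hΩ : IsAlgClosed Ω := IsAlgClosure.isAlgClosed K
    obtain ⟨i, hi⟩ := IsAlgClosed.exists_pow_nat_eq (-1 : Ω) (n := 2) two_pos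
    refine ⟨i, mem_rootsOfUnityTower_of_pow_eq_one (n := 2 ^ 2) (j := 2)
      (pow_dvd_pow_of_dvd (hpR 2 Nat.prime_two hB2) 2) ?_, hi⟩
    rw [sq (2 : ℕ), pow_mul, hi, neg_one_sq]
  · have hc0 : c ≠ 0 := by
      rintro rfl
      rw [zero_pow hn0.ne'] at hca
      exact haΩ hca.symm
    have h1 : β / c ∈ rootsOfUnityTower K Ω R :=
      mem_rootsOfUnityTower_of_pow_eq_one hj (by rw [div_pow, hβ, hca, div_self haΩ])
    have h2 : β = β / c * c := by field_simp
    rw [h2]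
    exact mul_mem h1 hc
  · rcases le_or_gt p B with hpB | hpB
    · have hmem : p * n ∈ A := ⟨⟨j + 1, by rw [pow_succ']; exact mul_dvd_mul (hpR p hp hpB) hj⟩,
        γ, hγ, by rw [pow_mul, hγβ, hβ]⟩
      have := hmax _ hmem
      have := hp.two_le
      nlinarith
    · exact forall_mem_rootsOfUnityTower_factorial_pow_ne ha hp hpB (hB p hpB) (γ ^ n)
        (pow_mem hγ n) (by rw [← pow_mul, mul_comm, pow_mul, hγβ, hβ])

end Core

/-! ### From binomials over `L` to hereditary irreducibility over `F` -/

/-- If an element of an extension containing a square root of `-1` is not a `p`-th power there for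
any prime `p`, then its minimal polynomial is hereditarily irreducible. -/
theorem hereditarilyIrreducible_minpoly {F Ω : Type*} [Field F] [Field Ω] [Algebra F Ω]
    (L : IntermediateField F Ω) {i β : Ω} (hi : i ∈ L) (hi2 : i ^ 2 = -1) (hβL : β ∈ L)
    (hβ : IsIntegral F β) (h : ∀ p : ℕ, p.Prime → ∀ γ ∈ L, γ ^ p ≠ β) :
    HereditarilyIrreducible (minpoly F β) := by
  intro m hm
  rw [expand_eq_comp_X_pow]
  refine irreducible_comp (minpoly.monic hβ) (monic_X_pow m) (minpoly.irreducible hβ) ?_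
  intro E _ _ x hx
  let β' : L := ⟨β, hβL⟩
  have hmin : minpoly F β' = minpoly F β :=
    (minpoly.algebraMap_eq (algebraMap L Ω).injective β').symm
  have hxint : IsIntegral F x := by
    by_contra hcon
    exact minpoly.ne_zero hβ (hx ▸ minpoly.eq_zero hcon)
  -- Any root `x` of the minimal polynomial of `β` gives an embedding of `F(x)` into `L` with `x ↦
  -- β`, along which irreducibility of `X ^ m - β` descends.
  let φ := (IntermediateField.adjoin.powerBasis hxint).lift β' (by
    rw [IntermediateField.adjoin.powerBasis_gen, IntermediateField.minpoly_gen, hx, ← hmin,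
      minpoly.aeval])
  have hφ : φ (IntermediateField.AdjoinSimple.gen F x) = β' := by
    rw [← IntermediateField.adjoin.powerBasis_gen hxint]
    exact PowerBasis.lift_gen _ _ _
  have hirr : Irreducible (X ^ m - C β' : L[X]) :=
    irreducible_X_pow_sub_C_of_forall_prime (i := ⟨i, hi⟩) (Subtype.ext hi2)
      (fun p hp b hb => h p hp b b.2 (congrArg Subtype.val hb)) hm
  have hmonic : (X ^ m - C (IntermediateField.AdjoinSimple.gen F x)).Monic :=
    monic_X_pow_sub_C _ hm.ne'
  rw [Polynomial.map_pow, map_X]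
  refine hmonic.irreducible_of_irreducible_map φ.toRingHom _ ?_
  have : (X ^ m - C (IntermediateField.AdjoinSimple.gen F x)).map φ.toRingHom = X ^ m - C β' := by
    rw [Polynomial.map_sub, Polynomial.map_pow, map_X, map_C]
    exact congrArg (fun t => X ^ m - C t) hφ
  rwa [this]

/-! ### Good heredity of products, and the rootlessness criterion -/

section Polynomials

variable {F : Type*} [Field F]

theorem HereditarilyIrreducible.of_associated {P Q : F[X]} (hP : HereditarilyIrreducible P)
    (h : Associated P Q) : HereditarilyIrreducible Q :=
  fun n hn => (h.map (expand F n : F[X] →* F[X])).irreducible (hP n hn)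

theorem HereditarilyIrreducible.expand {P : F[X]} (hP : HereditarilyIrreducible P) {m : ℕ}
    (hm : 0 < m) : HereditarilyIrreducible (expand F m P) :=
  fun n hn => by
    rw [expand_expand]
    exact hP _ (Nat.mul_pos hn hm)

theorem PolynomialGoodHeredity.of_isUnit {P : F[X]} (hP : IsUnit P) : PolynomialGoodHeredity P :=
  ⟨1, one_pos, 0, by simp, by
    rw [Multiset.prod_zero, expand_one]
    exact (associated_one_iff_isUnit.mpr hP).symm⟩

theorem PolynomialGoodHeredity.mul {P Q : F[X]} (hP : PolynomialGoodHeredity P)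
    (hQ : PolynomialGoodHeredity Q) : PolynomialGoodHeredity (P * Q) := by
  obtain ⟨n, hn, s, hs, hsP⟩ := hP
  obtain ⟨m, hm, t, ht, htQ⟩ := hQ
  refine ⟨m * n, Nat.mul_pos hm hn, s.map (expand F m) + t.map (expand F n), fun R hR => ?_, ?_⟩
  · rcases Multiset.mem_add.mp hR with h | h
    · obtain ⟨Q, hQ, rfl⟩ := Multiset.mem_map.mp h
      exact (hs Q hQ).expand hm
    · obtain ⟨Q, hQ, rfl⟩ := Multiset.mem_map.mp h
      exact (ht Q hQ).expand hn
  · rw [Multiset.prod_add, Multiset.prod_hom, Multiset.prod_hom, map_mul]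
    refine Associated.mul_mul ?_ ?_
    · rw [← expand_expand]
      exact hsP.map (Polynomial.expand F m : F[X] →* F[X])
    · rw [mul_comm m, ← expand_expand]
      exact htQ.map (Polynomial.expand F n : F[X] →* F[X])

/-- A field of good heredity is detected by rootlessness of its finite extensions. -/
theorem fieldGoodHeredity_of_fieldRootless
    (h : ∀ α : AlgebraicClosure F, FieldRootless (IntermediateField.adjoin F {α})) :
    FieldGoodHeredity F := by
  have hirr : ∀ P : F[X], Irreducible P →
      (∀ a : AlgebraicClosure F, aeval a P = 0 → a ≠ 0 ∧ ¬ IsUnityRoot a) →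
      PolynomialGoodHeredity P := by
    intro P hP hroots
    set Ω := AlgebraicClosure F
    obtain ⟨α, hα⟩ := IsAlgClosed.exists_aeval_eq_zero Ω P
      (Polynomial.degree_pos_of_irreducible hP).ne'
    obtain ⟨hα0, hαu⟩ := hroots α hα
    let K := IntermediateField.adjoin F {α}
    let a : K := IntermediateField.AdjoinSimple.gen F α
    have haα : algebraMap K Ω a = α := IntermediateField.AdjoinSimple.algebraMap_gen F α
    have hKΩ : IsAlgClosure K Ω := ⟨inferInstance, Algebra.IsAlgebraic.tower_top (K := F) K⟩
    have ha0 : a ≠ 0 := fun h0 => hα0 (by rw [← haα, h0, map_zero])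
    have hau : ¬ IsUnityRoot a := fun ⟨n, hn, h1⟩ => hαu ⟨n, hn, by
      rw [← haα, ← map_pow, h1, map_one]⟩
    obtain ⟨n, hn, L, ⟨i, hi, hi2⟩, hL⟩ := exists_pos_intermediateField_pow_ne (Ω := Ω) ha0
      fun N hN => h α (a ^ N) (pow_ne_zero N ha0) fun ⟨m, hm, h1⟩ =>
        hau ⟨N * m, Nat.mul_pos hN hm, by rw [pow_mul, h1]⟩
    have hPn : Polynomial.expand F n P ≠ 0 := (expand_ne_zero hn).mpr hP.ne_zero
    refine ⟨n, hn, UniqueFactorizationMonoid.factors (Polynomial.expand F n P), fun Q hQ => ?_,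
      UniqueFactorizationMonoid.factors_prod hPn⟩
    have hQirr := UniqueFactorizationMonoid.irreducible_of_factor Q hQ
    obtain ⟨β, hβ⟩ := IsAlgClosed.exists_aeval_eq_zero Ω Q
      (Polynomial.degree_pos_of_irreducible hQirr).ne'
    have hβn : aeval (β ^ n) P = 0 := by
      rw [← expand_aeval]
      exact aeval_eq_zero_of_dvd_aeval_eq_zero (UniqueFactorizationMonoid.dvd_of_mem_factors hQ) hβ
    have hconj : IsConjRoot F α (β ^ n) := by
      rw [isConjRoot_def, ← minpoly.eq_of_irreducible hP hα, ← minpoly.eq_of_irreducible hP hβn]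
    -- `β ^ n` is only a conjugate of `α`; replacing `β` by `σ β` makes it an `n`-th root of `α`
    -- without changing the minimal polynomial.
    obtain ⟨σ, hσ⟩ := isConjRoot_iff_exists_algEquiv.mp hconj
    obtain ⟨hmem, hpow⟩ := hL (σ β) (by rw [← map_pow, hσ, haα])
    have hint : IsIntegral F (σ β) := Algebra.IsIntegral.isIntegral _
    have hred := hereditarilyIrreducible_minpoly (L.restrictScalars F) hi hi2 hmem hint hpow
    refine hred.of_associated ((minpoly.irreducible hint).associated_of_dvd hQirr ?_)
    rw [minpoly.algEquiv_eq]
    exact minpoly.dvd F β hβ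
  intro P
  induction P using WfDvdMonoid.induction_on_irreducible with
  | zero => exact fun h0 => absurd rfl (h0 0 (by simp)).1
  | unit u hu => exact fun _ => .of_isUnit hu
  | mul P Q _ hQ ih =>
    exact fun hroots => (hirr Q hQ fun a ha => hroots a (by simp [ha])).mul
      (ih fun a ha => hroots a (by simp [ha]))

end Polynomials

/-! ### Rootlessness of finitely generated extensions -/

section Rootless

variable {F K : Type*} [Field F] [Field K]

theorem IsUnityRoot.isIntegral [Algebra F K] {ζ : K} (h : IsUnityRoot ζ) : IsIntegral F ζ := by
  obtain ⟨n, hn, h⟩ := h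
  exact IsIntegral.of_pow hn (h ▸ isIntegral_one)

theorem ElementRootlessModtor.elementRootless {a : F} (h : ElementRootlessModtor a) :
    ElementRootless a :=
  h.subset fun _ ⟨hn, x, hx⟩ => ⟨hn, 1, ⟨1, one_pos, one_pow 1⟩, x, by rw [hx, one_mul]⟩

theorem FieldRootlessModtor.fieldRootless (h : FieldRootlessModtor F) : FieldRootless F :=
  fun a ha hu => (h a ha hu).elementRootless

variable [Algebra F K]

/-- If `a` is transcendental over `F`, then `X ^ n - c a` is irreducible over `F(a)` for `c ≠ 0`. -/
theorem irreducible_X_pow_sub_C_of_transcendental {a : K} (ha : Transcendental F a) {c : F}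
    (hc : c ≠ 0) {n : ℕ} (hn : 0 < n) :
    Irreducible (X ^ n - C (c • IntermediateField.AdjoinSimple.gen F a)) := by
  let M := IntermediateField.adjoin F {a}
  let g : M := IntermediateField.AdjoinSimple.gen F a
  have hg : Transcendental F g := fun h => ha (h.algebraMap (A := K))
  let _ : Algebra F[X] M := (aeval g : F[X] →ₐ[F] M).toRingHom.toAlgebra
  have hmap : ∀ p : F[X], algebraMap F[X] M p = aeval g p := fun p => rfl
  have hinj : Function.Injective (algebraMap F[X] M) := transcendental_iff_injective.mp hg
  have : FaithfulSMul F[X] M := (faithfulSMul_iff_algebraMap_injective F[X] M).mpr hinj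
  have hfrac : IsFractionRing F[X] M := IsFractionRing.of_field _ _ fun z => by
    obtain ⟨r, s, hrs⟩ := (IntermediateField.mem_adjoin_simple_iff F (z : K)).mp z.2
    refine ⟨r, s, Subtype.ext ?_⟩
    rw [hrs, hmap, hmap]
    have hval : ∀ p : F[X], ((aeval g p : M) : K) = aeval a p := fun p =>
      (aeval_algebraMap_apply K g p).symm
    push_cast
    rw [hval, hval]
  -- Eisenstein at the prime `X` of `F[X]`, whose fraction field is `F(a)`; Gauss's lemma then
  -- transfers irreducibility.
  have hirr : Irreducible (X ^ n - C (C c * X) : F[X][X]) := by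
    have hmonic : (X ^ n - C (C c * X) : F[X][X]).Monic := monic_X_pow_sub_C _ hn.ne'
    refine IsEisensteinAt.irreducible (𝓟 := Ideal.span {X}) ⟨?_, ?_, ?_⟩ ?_ hmonic.isPrimitive ?_
    · rw [hmonic.leadingCoeff, Ideal.mem_span_singleton]
      exact fun h => not_isUnit_X (isUnit_of_dvd_one h)
    · intro m hm
      rw [natDegree_X_pow_sub_C] at hm
      rw [coeff_sub, coeff_X_pow, if_neg hm.ne, zero_sub, coeff_C]
      split_ifs
      · exact neg_mem (Ideal.mul_mem_left _ _ (Ideal.mem_span_singleton_self _))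
      · simp
    · rw [coeff_sub, coeff_X_pow, if_neg hn.ne, zero_sub, coeff_C_zero, Ideal.span_singleton_pow,
        Ideal.mem_span_singleton, dvd_neg, X_pow_dvd_iff]
      intro h
      have := h 1 one_lt_two
      rw [coeff_C_mul, coeff_X_one, mul_one] at this
      exact hc this
    · exact (Ideal.span_singleton_prime X_ne_zero).mpr prime_X
    · rwa [natDegree_X_pow_sub_C]
  rw [(monic_X_pow_sub_C _ hn.ne').irreducible_iff_irreducible_map_fraction_map (K := M)] at hirr
  rw [Polynomial.map_sub, Polynomial.map_pow, map_X, map_C, hmap, map_mul, aeval_C, aeval_X,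
    ← Algebra.smul_def] at hirr
  exact hirr

/-- All roots of unity of `K` lie in the algebraic closure `k` of `F` in `K`, so a solution of `x ^
n = ζ * a` has degree exactly `n` over `k(a)`, and such degrees are bounded. -/
theorem elementRootlessModtor_of_transcendental [Algebra.EssFiniteType F K] {a : K}
    (ha : Transcendental F a) : ElementRootlessModtor a := by
  let k := algebraicClosure F K
  have hak : Transcendental k a := ha.algebraicClosure
  have : Algebra.EssFiniteType k K := .of_comp F k K
  let M := IntermediateField.adjoin k {a}
  have : Algebra.EssFiniteType M K := .of_comp k M K
  obtain ⟨D, hD⟩ := exists_natDegree_minpoly_le (F := M) (K := K)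
  refine (Set.finite_Iic D).subset fun n ⟨hn, ζ, hζ, x, hx⟩ => ?_
  let ζ' : k := ⟨ζ, mem_algebraicClosure_iff.mpr (hζ.isIntegral (F := F)).isAlgebraic⟩
  have hζ0 : ζ' ≠ 0 := fun h0 => by
    obtain ⟨m, hm, h1⟩ := hζ
    have : ζ = 0 := congrArg Subtype.val h0
    rw [this, zero_pow hm.ne'] at h1
    exact zero_ne_one h1
  have hirr := irreducible_X_pow_sub_C_of_transcendental hak hζ0 hn
  set b : M := ζ' • IntermediateField.AdjoinSimple.gen k a
  have hroot : aeval x (X ^ n - C b) = 0 := by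
    rw [map_sub, map_pow, aeval_X, aeval_C, hx, sub_eq_zero]
    rfl
  have hmin := minpoly.eq_of_irreducible_of_monic hirr hroot (monic_X_pow_sub_C _ hn.ne')
  have hint : IsIntegral M x := ⟨_, monic_X_pow_sub_C b hn.ne', hroot⟩
  have := hD x hint.isAlgebraic
  rwa [← hmin, natDegree_X_pow_sub_C] at this

theorem elementRootless_of_polynomialGoodHeredity [Algebra.EssFiniteType F K] {a : K}
    (ha : IsAlgebraic F a) (hP : PolynomialGoodHeredity (minpoly F a)) : ElementRootless a := by
  obtain ⟨D, hD⟩ := exists_natDegree_minpoly_le (F := F) (K := K)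
  obtain ⟨n, hn, s, hs, hsP⟩ := hP
  refine (Set.finite_Iic (D * n)).subset fun m ⟨hm, x, hx⟩ => ?_
  have hxint : IsIntegral F x := IsIntegral.of_pow hm (hx ▸ ha.isIntegral)
  let Ω := AlgebraicClosure K
  -- `δ` is a root of some irreducible `Q(X ^ m)`, hence of degree at least `m` over `F`; as an
  -- `n`-th root of `x`, it has degree at most `D * n`.
  obtain ⟨δ, hδ⟩ := IsAlgClosed.exists_pow_nat_eq (algebraMap K Ω x) hn
  have hδ1 : aeval δ (expand F m (expand F n (minpoly F a))) = 0 := by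
    rw [expand_aeval, expand_aeval, ← pow_mul, mul_comm, pow_mul, hδ, ← map_pow, hx,
      aeval_algebraMap_apply, minpoly.aeval, map_zero]
  have hδ2 : aeval δ (expand F m s.prod) = 0 :=
    aeval_eq_zero_of_dvd_aeval_eq_zero
      (hsP.map (expand F m : F[X] →* F[X])).symm.dvd hδ1
  obtain ⟨Q, hQ, hδQ⟩ : ∃ Q ∈ s, aeval δ (expand F m Q) = 0 := by
    rw [map_multiset_prod, map_multiset_prod, Multiset.prod_eq_zero_iff] at hδ2
    simpa using hδ2
  have hQirr := hs Q hQ m hm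
  have hQ1 : Irreducible Q := by simpa using hs Q hQ 1 one_pos
  have hassoc : (minpoly F δ).natDegree = Q.natDegree * m := by
    rw [← natDegree_expand]
    have hδint : IsIntegral F δ := IsAlgebraic.isIntegral ⟨_, hQirr.ne_zero, hδQ⟩
    exact natDegree_eq_of_degree_eq (degree_eq_degree_of_associated
      ((minpoly.irreducible hδint).associated_of_dvd hQirr (minpoly.dvd F δ hδQ)))
  have hle : (minpoly F δ).natDegree ≤ (minpoly F x).natDegree * n := by
    rw [← natDegree_expand]
    refine natDegree_le_of_dvd (minpoly.dvd F δ ?_)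
      ((expand_ne_zero hn).mpr (minpoly.ne_zero hxint))
    rw [expand_aeval, hδ, aeval_algebraMap_apply, minpoly.aeval, map_zero]
  have hQpos : 0 < Q.natDegree := hQ1.natDegree_pos
  have := hD x hxint.isAlgebraic
  rw [Set.mem_Iic]
  calc m ≤ Q.natDegree * m := Nat.le_mul_of_pos_left m hQpos
    _ ≤ (minpoly F x).natDegree * n := hassoc ▸ hle
    _ ≤ D * n := Nat.mul_le_mul_right n this

/-- Finitely generated extensions of a field of good heredity are rootless. -/
theorem FieldGoodHeredity.fieldRootless [Algebra.EssFiniteType F K] (hF : FieldGoodHeredity F) :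
    FieldRootless K := by
  intro a ha hau
  by_cases halg : IsAlgebraic F a
  · refine elementRootless_of_polynomialGoodHeredity halg (hF _ fun b hb => ?_)
    have hirr := minpoly.irreducible halg.isIntegral
    have hdvd : ∀ q : F[X], aeval b q = 0 → aeval a q = 0 := fun q hq => by
      refine aeval_eq_zero_of_dvd_aeval_eq_zero ?_ (minpoly.aeval F a)
      rw [minpoly.eq_of_irreducible_of_monic hirr hb (minpoly.monic halg.isIntegral)]
      exact minpoly.dvd F b hq
    refine ⟨fun hb0 => ha ?_, fun ⟨n, hn, h1⟩ => hau ⟨n, hn, ?_⟩⟩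
    · simpa using hdvd X (by simpa using hb0)
    · have := hdvd (X ^ n - 1) (by simp [h1])
      simpa [sub_eq_zero] using this
  · exact (elementRootlessModtor_of_transcendental halg).elementRootless

theorem FieldGoodHeredity.of_essFiniteType [Algebra.EssFiniteType F K]
    (hF : FieldGoodHeredity F) : FieldGoodHeredity K := by
  refine fieldGoodHeredity_of_fieldRootless fun α => ?_
  have hfin : FiniteDimensional K (IntermediateField.adjoin K {α}) :=
    IntermediateField.adjoin.finiteDimensional (Algebra.IsIntegral.isIntegral α)
  have : Algebra.EssFiniteType F (IntermediateField.adjoin K {α}) :=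
    .comp F K (IntermediateField.adjoin K {α})
  exact hF.fieldRootless

end Rootless

/-! ### Fields whose nonzero elements are roots of unity -/

section Torsion

theorem isUnityRoot_of_isAlgebraic {k E : Type*} [Field k] [Finite k] [Field E] [Algebra k E]
    {a : E} (ha : IsAlgebraic k a) (ha0 : a ≠ 0) : IsUnityRoot a := by
  have hfin : FiniteDimensional k (IntermediateField.adjoin k {a}) :=
    IntermediateField.adjoin.finiteDimensional ha.isIntegral
  have : Finite (IntermediateField.adjoin k {a}) := Module.finite_of_finite k
  let g := IntermediateField.AdjoinSimple.gen k a
  have hg : (g : E) = a := IntermediateField.AdjoinSimple.coe_gen k a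
  have hg0 : g ≠ 0 := fun h => ha0 (by rw [← hg, h]; rfl)
  obtain ⟨n, hn, h1⟩ := isOfFinOrder_iff_pow_eq_one.mp (isOfFinOrder_of_finite (Units.mk0 g hg0))
  refine ⟨n, hn, ?_⟩
  have h2 : g ^ n = 1 := by simpa using congrArg Units.val h1
  rw [← hg, ← SubmonoidClass.coe_pow, h2]
  rfl

/-- Only nonzero constants satisfy the condition on zeros, and they are empty products. -/
theorem fieldGoodHeredity_of_forall_isUnityRoot {F : Type*} [Field F]
    (h : ∀ a : AlgebraicClosure F, a ≠ 0 → IsUnityRoot a) : FieldGoodHeredity F := by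
  intro P hP
  refine .of_isUnit ?_
  by_contra hu
  obtain ⟨a, ha⟩ := IsAlgClosed.exists_aeval_eq_zero (AlgebraicClosure F) P fun h0 => by
    rcases eq_or_ne P 0 with rfl | hP0
    · simp at h0
    · exact hu (isUnit_iff_degree_eq_zero.mpr h0)
  exact (hP a ha).2 (h a (hP a ha).1)

theorem fieldGoodHeredity_of_finite {k : Type*} [Field k] [Finite k] : FieldGoodHeredity k :=
  fieldGoodHeredity_of_forall_isUnityRoot fun a ha =>
    isUnityRoot_of_isAlgebraic (k := k) (Algebra.IsAlgebraic.isAlgebraic a) ha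

theorem FieldGoodHeredity.isUnityRoot_of_isAlgClosed {F : Type*} [Field F] [IsAlgClosed F]
    (hF : FieldGoodHeredity F) {a : F} (ha : a ≠ 0) : IsUnityRoot a := by
  by_contra hau
  obtain ⟨n, hn, s, hs, hsP⟩ := hF (X - C a) fun b hb => by
    rw [map_sub, aeval_X, aeval_C, sub_eq_zero] at hb
    subst hb
    refine ⟨fun h => ha ((map_eq_zero _).mp h), fun ⟨n, hn, h1⟩ => hau ⟨n, hn, ?_⟩⟩
    rw [← map_pow] at h1
    exact (algebraMap F (AlgebraicClosure F)).injective (by rw [h1, map_one])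
  -- `X ^ n - a` is not constant, so a factor `Q` exists; but `Q(X ^ 2)` would be irreducible of
  -- even degree.
  rcases s.empty_or_exists_mem with rfl | ⟨Q, hQ⟩
  · have h1 := natDegree_eq_of_degree_eq (degree_eq_degree_of_associated hsP)
    rw [natDegree_expand, natDegree_X_sub_C, Multiset.prod_zero, natDegree_one] at h1
    lia
  · have h1 : _ = 1 := natDegree_eq_of_degree_eq_some
      (IsAlgClosed.degree_eq_one_of_irreducible F (hs Q hQ 2 two_pos))
    rw [natDegree_expand] at h1
    lia

theorem fieldGoodHeredity_algebraicClosure_zmod (p : ℕ) [Fact p.Prime] :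
    FieldGoodHeredity (AlgebraicClosure (ZMod p)) :=
  fieldGoodHeredity_of_forall_isUnityRoot fun a ha =>
    have := Algebra.IsAlgebraic.trans (ZMod p) (AlgebraicClosure (ZMod p))
      (AlgebraicClosure (AlgebraicClosure (ZMod p)))
    isUnityRoot_of_isAlgebraic (k := ZMod p) (Algebra.IsAlgebraic.isAlgebraic a) ha

theorem fieldGoodHeredity_iff_of_isAlgClosed (F : Type*) [Field F] [IsAlgClosed F] :
    FieldGoodHeredity F ↔
      ∃ (p : ℕ) (_ : Fact p.Prime), Nonempty (F ≃+* AlgebraicClosure (ZMod p)) := by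
  constructor
  · intro hF
    obtain ⟨p, hp⟩ := CharP.exists F
    rcases CharP.char_is_prime_or_zero F p with hpp | rfl
    · have : Fact p.Prime := ⟨hpp⟩
      let _ : Algebra (ZMod p) F := ZMod.algebra F p
      have halg : Algebra.IsAlgebraic (ZMod p) F := ⟨fun a => by
        rcases eq_or_ne a 0 with rfl | ha
        · exact isAlgebraic_zero
        · exact (hF.isUnityRoot_of_isAlgClosed ha).isIntegral.isAlgebraic⟩
      have : IsAlgClosure (ZMod p) F := ⟨inferInstance, halg⟩
      exact ⟨p, ‹_›, ⟨(IsAlgClosure.equiv (ZMod p) F (AlgebraicClosure (ZMod p))).toRingEquiv⟩⟩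
    · have : CharZero F := CharP.charP_to_charZero F
      obtain ⟨n, hn, h1⟩ := hF.isUnityRoot_of_isAlgClosed (two_ne_zero (α := F))
      have h2 : (2 : ℕ) ^ n = 1 := by exact_mod_cast h1
      exact absurd h2 (Nat.one_lt_two_pow hn.ne').ne'
  · rintro ⟨p, _, ⟨e⟩⟩
    refine fieldGoodHeredity_of_forall_isUnityRoot fun b hb => ?_
    obtain ⟨a, rfl⟩ := (IsAlgClosed.algebraMap_bijective_of_isIntegral
      (k := F) (K := AlgebraicClosure F)).2 b
    have ha : e a ≠ 0 := by
      rw [_root_.map_ne_zero]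
      exact fun h => hb (by rw [h, map_zero])
    obtain ⟨n, hn, h1⟩ := isUnityRoot_of_isAlgebraic (k := ZMod p)
      (Algebra.IsAlgebraic.isAlgebraic (e a)) ha
    refine ⟨n, hn, ?_⟩
    rw [← map_pow] at h1 ⊢
    rw [e.injective (h1.trans e.map_one.symm), map_one]

end Torsion

/-! ### Number fields and function fields -/

section Global

/-- Northcott's argument: solutions for infinitely many `n` have bounded denominators and
conjugates, so two of them coincide, which forces `a` to be a root of unity. -/
theorem fieldRootlessModtor_of_numberField (K : Type*) [Field K] [NumberField K] :
    FieldRootlessModtor K := by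
  intro a ha hau
  obtain ⟨N, hN0, hN⟩ := ((IsFractionRing.isAlgebraic_iff ℤ ℚ K).mpr
    (Algebra.IsAlgebraic.isAlgebraic a)).exists_integral_multiple
  set B : ℝ := 1 + ∑ φ : K →+* ℂ, ‖φ a‖
  have hB1 : 1 ≤ B := le_add_of_nonneg_right (Finset.sum_nonneg fun φ _ => norm_nonneg _)
  have hBa : ∀ φ : K →+* ℂ, ‖φ a‖ ≤ B := fun φ =>
    (Finset.single_le_sum (f := fun φ : K →+* ℂ => ‖φ a‖) (fun φ _ => norm_nonneg _)
      (Finset.mem_univ φ)).trans (le_add_of_nonneg_left zero_le_one)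
  have hfin := NumberField.Embeddings.finite_of_norm_le K ℂ (‖(N : ℂ)‖ * B)
  rw [ElementRootlessModtor]
  by_contra hinf
  choose! ζ hζ x hx using fun (n : ℕ)
    (hn : n ∈ {n : ℕ | 0 < n ∧ ∃ ζ : K, IsUnityRoot ζ ∧ ∃ x : K, x ^ n = ζ * a}) => hn.2
  have hmaps : Set.MapsTo (fun n => (N : K) * x n)
      {n : ℕ | 0 < n ∧ ∃ ζ : K, IsUnityRoot ζ ∧ ∃ x : K, x ^ n = ζ * a}
      {x : K | IsIntegral ℤ x ∧ ∀ φ : K →+* ℂ, ‖φ x‖ ≤ ‖(N : ℂ)‖ * B} := by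
    intro n hn
    have hn0 : 0 < n := hn.1
    refine ⟨IsIntegral.of_pow hn0 ?_, fun φ => ?_⟩
    · obtain ⟨m, rfl⟩ : ∃ m, n = m + 1 := ⟨n - 1, by lia⟩
      have hζint : IsIntegral ℤ (ζ (m + 1)) := by
        obtain ⟨l, hl, h1⟩ := hζ _ hn
        exact IsIntegral.of_pow hl (h1 ▸ isIntegral_one)
      -- One factor `N` is kept aside to make `a` integral.
      have : ((N : K) * x (m + 1)) ^ (m + 1) = (N : K) ^ m * ζ (m + 1) * (N • a) := by
        rw [mul_pow, hx _ hn, zsmul_eq_mul]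
        ring
      rw [this]
      have hNint : IsIntegral ℤ (N : K) := isIntegral_algebraMap (R := ℤ) (A := K) (x := N)
      exact ((hNint.pow m).mul hζint).mul hN
    · rw [map_mul, map_intCast, norm_mul]
      refine mul_le_mul_of_nonneg_left ?_ (norm_nonneg _)
      by_contra hlt
      push Not at hlt
      have h1 : ‖φ (x n)‖ ^ n = ‖φ a‖ := by
        have hζ1 : ‖φ (ζ n)‖ = 1 := by
          obtain ⟨l, hl, h1⟩ := hζ _ hn
          exact (pow_eq_one_iff_of_nonneg (norm_nonneg _) hl.ne').mp
            (by rw [← norm_pow, ← map_pow, h1, map_one, norm_one])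
        rw [← norm_pow, ← map_pow, hx _ hn, map_mul, norm_mul, hζ1, one_mul]
      have h2 := le_self_pow₀ (hB1.trans hlt.le) hn0.ne'
      have h3 := hBa φ
      linarith
  obtain ⟨m, hm, n, hn, hmn, heq⟩ :=
    Set.Infinite.exists_lt_map_eq_of_mapsTo hinf hmaps hfin
  have hNK : (N : K) ≠ 0 := Int.cast_ne_zero.mpr hN0
  have hxmn : x m = x n := mul_left_cancel₀ hNK heq
  obtain ⟨i, hi, hζi⟩ := hζ m hm
  obtain ⟨j, hj, hζj⟩ := hζ n hn
  have h1 : x m ^ (m * (i * j)) = a ^ (i * j) := by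
    rw [pow_mul, hx m hm, mul_pow, pow_mul (ζ m), hζi, one_pow, one_mul]
  have h2 : x m ^ (n * (i * j)) = a ^ (i * j) := by
    rw [hxmn, pow_mul, hx n hn, mul_pow, mul_comm i, pow_mul (ζ n), hζj, one_pow, one_mul]
  have hij : 0 < i * j := Nat.mul_pos hi hj
  have hx0 : x m ≠ 0 := fun h0 => by
    rw [h0, zero_pow (Nat.mul_pos hm.1 hij).ne'] at h1
    exact pow_ne_zero _ ha h1.symm
  have h3 : x m ^ ((n - m) * (i * j)) = 1 := by
    refine mul_left_cancel₀ (pow_ne_zero (m * (i * j)) hx0) ?_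
    rw [← pow_add, ← add_mul, Nat.add_sub_cancel' hmn.le, h2, h1, mul_one]
  refine hau ⟨(i * j) * ((n - m) * (i * j)),
    Nat.mul_pos hij (Nat.mul_pos (Nat.sub_pos_of_lt hmn) hij), ?_⟩
  rw [pow_mul, ← h1, ← pow_mul, mul_comm, pow_mul, h3, one_pow]

theorem fieldGoodHeredity_of_numberField (K : Type*) [Field K] [NumberField K] :
    FieldGoodHeredity K :=
  fieldGoodHeredity_of_fieldRootless fun α => by
    have hfin : FiniteDimensional K (IntermediateField.adjoin K {α}) :=
      IntermediateField.adjoin.finiteDimensional (Algebra.IsIntegral.isIntegral α)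
    have : NumberField (IntermediateField.adjoin K {α}) := NumberField.of_module_finite K _
    exact (fieldRootlessModtor_of_numberField _).fieldRootless

theorem IsGlobalField.rootless_and_goodHeredity {K : Type*} [Field K] (hK : IsGlobalField K) :
    FieldRootless K ∧ FieldRootlessModtor K ∧ FieldGoodHeredity K := by
  rcases hK with hK | ⟨k, _, _, _, hfin⟩
  · have h := fieldRootlessModtor_of_numberField K
    exact ⟨h.fieldRootless, h, fieldGoodHeredity_of_numberField K⟩
  · let _ : Algebra k K := ((algebraMap (RatFunc k) K).comp (algebraMap k (RatFunc k))).toAlgebra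
    have : IsScalarTower k (RatFunc k) K := .of_algebraMap_eq fun _ => rfl
    have : Algebra.EssFiniteType k[X] (RatFunc k) := .of_isLocalization _ (nonZeroDivisors k[X])
    have : Algebra.EssFiniteType k (RatFunc k) := .comp k k[X] (RatFunc k)
    have : Algebra.EssFiniteType k K := .comp k (RatFunc k) K
    -- Nonzero elements algebraic over the finite field `k` are roots of unity, so `a` is
    -- transcendental.
    have h : FieldRootlessModtor K := fun a ha hau =>
      elementRootlessModtor_of_transcendental (F := k)
        fun halg => hau (isUnityRoot_of_isAlgebraic halg ha)
    exact ⟨h.fieldRootless, h, fieldGoodHeredity_of_finite.of_essFiniteType (F := k)⟩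

end Global

theorem proposition32 :
    -- The algebraic closures of the prime fields of positive characteristic have good heredity,
    (∀ (p : ℕ) [Fact p.Prime], FieldGoodHeredity (AlgebraicClosure (ZMod p))) ∧
    -- and, up to isomorphism, they are the only algebraically closed fields that do.
    (∀ (F : Type*) [Field F] [IsAlgClosed F],
      FieldGoodHeredity F ↔
        ∃ (p : ℕ) (_ : Fact p.Prime), Nonempty (F ≃+* AlgebraicClosure (ZMod p))) ∧
    -- Global fields.
    (∀ (K : Type*) [Field K], IsGlobalField K →
      FieldRootless K ∧ FieldRootlessModtor K ∧ FieldGoodHeredity K) ∧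
    -- Finitely generated field extensions.
    (∀ (F : Type*) (E : Type*) [Field F] [Field E] [Algebra F E],
      (⊤ : IntermediateField F E).FG → FieldGoodHeredity F → FieldGoodHeredity E) := by
  refine ⟨fun p _ => fieldGoodHeredity_algebraicClosure_zmod p,
    fun F _ _ => fieldGoodHeredity_iff_of_isAlgClosed F,
    fun K _ hK => hK.rootless_and_goodHeredity, fun F E _ _ _ hfg hF => ?_⟩
  have : Algebra.EssFiniteType F E := IntermediateField.fg_top_iff.mp hfg
  exact hF.of_essFiniteType
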